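/- Let $\mathcal M_0$ be the set of $3\times 3$ real positive definite matrices $\Sigma=(\sigma_{ij})$ with $\sigma_{12}=0$ (that is, $X_1\perp X_2$ when $(X_1,X_2,X_3)\sim N(0,\Sigma)$), and $\mathcal M_1$ the set of those with $\sigma_{12}\sigma_{33}=\sigma_{13}\sigma_{23}$ (that is, $X_1\perp X_2\mid X_3$). Write $P_\Sigma=N(0,\Sigma)$ and let $P_\Sigma^{n}$ be the law of $n$ independent observations from $P_\Sigma$. Let $\Sigma^{(0)}_k\in\mathcal M_0\setminus\mathcal M_1$, $k=0,1,2,\dots$, be a sequence converging to a positive definite matrix, and let $\rho_{13},\rho_{23}$ (depending on $k$) be the correlations $\rho_{ij}=\sigma_{ij}/\sqrt{\sigma_{ii}\sigma_{jj}}$ of $\Sigma^{(0)}_k$. Then, for each $k$, there is exactly one minimizer $\Sigma^{(1)}_k$ of $\mathrm{KL}(P_{\Sigma^{(0)}_k}\,\|\,P_{\Sigma})$ over $\Sigma\in\mathcal M_1$; it has the same entries as $\Sigma^{(0)}_k$ except that its $(1,2)$ and $(2,1)$ entries are $\sigma_{13}\sigma_{23}/\sigma_{33}=\rho_{13}\rho_{23}\sqrt{\sigma_{11}\sigma_{22}}$.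 For this closest pair, as $k\to\infty$, $$H^2\bigl(P_{\Sigma^{(0)}_k},P_{\Sigma^{(1)}_k}\bigr)\asymp \rho_{13}^2\rho_{23}^2,\qquad H^2(P,Q)=\tfrac12\int(\sqrt p-\sqrt q)^2\,d\mu .$$ Moreover, let $(n_k)$ be any sequence of sample sizes (for instance $n_k=k$), and let $e_k$ be the optimal total error of testing $P^{n_k}_{\Sigma^{(0)}_k}$ against $P^{n_k}_{\Sigma^{(1)}_k}$, i.e. the infimum over all (possibly randomized) tests of the sum of the type-I and type-II error probabilities. Then: 1. consistent model selection is possible, i.e. there are (nonrandomized, measurable) decision rules, choosing between the two models from $n_k$ observations, whose probabilities of a wrong choice under $P^{n_k}_{\Sigma^{(0)}_k}$ and under $P^{n_k}_{\Sigma^{(1)}_k}$ both tend to $0$, if and only if $n_k=\omega\bigl(1/(\rho_{13}^2\rho_{23}^2)\bigr)$; the same condition is necessary and sufficient for $e_k\to0$; 2. the asymptotic optimal total error is strictly between $0$ and $1$, i.e. $0<\liminf_k e_k\le\limsup_k e_k<1$, if and only if $n_k\asymp 1/(\rho_{13}^2\rho_{23}^2)$. Here $a_k=\omega(b_k)$ means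 $b_k/a_k\to0$, and $a_k\asymp b_k$ means $a_k=O(b_k)$ and $b_k=O(a_k)$. -/

import Mathlib

open MeasureTheory ProbabilityTheory Filter Topology Asymptotics
open scoped ENNReal

noncomputable section

namespace MarginalVsConditional

/-- Real `3 × 3` matrices; `X₁, X₂, X₃` correspond to the indices `0, 1, 2`. -/
abbrev Mat3 : Type := Matrix (Fin 3) (Fin 3) ℝ

/-- The model `X₁ ⟂ X₂`: positive definite covariances with `σ₁₂ = 0`. -/
def model0 : Set Mat3 := {S | S.PosDef ∧ S 0 1 = 0}

/-- The model `X₁ ⟂ X₂ | X₃`: positive definite covariances with `σ₁₂ σ₃₃ = σ₁₃ σ₂₃`. -/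
def model1 : Set Mat3 := {S | S.PosDef ∧ S 0 1 * S 2 2 = S 0 2 * S 1 2}

/-- The correlation `ρᵢⱼ = σᵢⱼ / √(σᵢᵢ σⱼⱼ)`. -/
def corr (S : Mat3) (i j : Fin 3) : ℝ := S i j / √(S i i * S j j)

/-- The law `N(0, S)` on `ℝ³`. -/
def gaussianLaw (S : Mat3) : Measure (EuclideanSpace ℝ (Fin 3)) := multivariateGaussian 0 S

/-- The law of `n` independent observations from `N(0, S)`. -/
def sampleLaw (S : Mat3) (n : ℕ) : Measure (Fin n → EuclideanSpace ℝ (Fin 3)) :=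
  Measure.pi fun _ => gaussianLaw S

/-- `T` is a Kullback-Leibler projection of `S` to the model `M`: it minimizes
`KL(N(0, S) ‖ N(0, T))` over `T ∈ M`. -/
def IsKLProjection (M : Set Mat3) (S T : Mat3) : Prop :=
  T ∈ M ∧ ∀ T' ∈ M, InformationTheory.klDiv (gaussianLaw S) (gaussianLaw T) ≤
    InformationTheory.klDiv (gaussianLaw S) (gaussianLaw T')

/-- The matrix with the entries of `S`, except that `σ₁₂` is replaced by `σ₁₃ σ₂₃ / σ₃₃`, that is, by
`ρ₁₃ ρ₂₃ √(σ₁₁ σ₂₂)`. -/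
def closestCov (S : Mat3) : Mat3 :=
  !![S 0 0, S 0 2 * S 1 2 / S 2 2, S 0 2;
     S 0 2 * S 1 2 / S 2 2, S 1 1, S 1 2;
     S 0 2, S 1 2, S 2 2]

/-- The squared Hellinger distance `(1/2) ∫ (√p - √q)² dμ`, with `p, q` the densities of `P, Q`
with respect to a measure `μ` that dominates both of them. -/
def hellingerSq {X : Type*} [MeasurableSpace X] (μ P Q : Measure X) : ℝ :=
  (1 / 2) * ∫ x, (√(P.rnDeriv μ x).toReal - √(Q.rnDeriv μ x).toReal) ^ 2 ∂μ

/-- Randomized tests: `φ x` is the probability of rejecting the null hypothesis at the data `x`. -/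
def IsTest {X : Type*} [MeasurableSpace X] (φ : X → ℝ) : Prop :=
  Measurable φ ∧ ∀ x, 0 ≤ φ x ∧ φ x ≤ 1

/-- The optimal total error of testing `P` versus `Q`: the infimum over all tests of the sum of the
type-I error (under `P`) and the type-II error (under `Q`). -/
def optimalTotalError {X : Type*} [MeasurableSpace X] (P Q : Measure X) : ℝ :=
  ⨅ φ : {φ : X → ℝ // IsTest φ}, (∫ x, φ.1 x ∂P) + ∫ x, (1 - φ.1 x) ∂Q

/-- Consistent selection between two sequences of laws: some sequence of decision rules, choosing
`Q k` on the measurable set `A k` and `P k` on its complement, has both probabilities of a wrong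
choice tending to zero. -/
def ConsistentSelection {X : ℕ → Type*} [∀ k, MeasurableSpace (X k)]
    (P Q : ∀ k, Measure (X k)) : Prop :=
  ∃ A : ∀ k, Set (X k), (∀ k, MeasurableSet (A k)) ∧
    Tendsto (fun k => P k (A k)) atTop (𝓝 0) ∧ Tendsto (fun k => Q k (A k)ᶜ) atTop (𝓝 0)

end MarginalVsConditional

end


/-!
Let `A` be the Hellinger affinity of `P_{Σ⁽⁰⁾}` and `P_{Σ⁽¹⁾}`, so that `H² = 1 - A` and the
affinity of the `n`-fold products is `A ^ n = exp (-x)` with `x = -n log A`. The optimal total error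
of testing `P` against `Q` is `e = ∫ min p q`. Clearly `e ≤ ∫ √(pq)`, and Cauchy–Schwarz applied to
`√(pq) = √(min p q) √(max p q)` gives `(∫ √(pq))² ≤ e (2 - e)`. Hence `e ≤ exp (-x)` and
`exp (-2x) ≤ e (2 - e)`: the error tends to `0` iff `x → ∞`, and it stays away from `0` and `1` iff
`x` stays away from `∞` and `0`. Since `-log A ≍ H²` as long as `H²` stays away from `1`, only the
order of `H²` matters.

The Kullback-Leibler projection is found by a Pythagorean identity: for `T ∈ model1` the
precision matrix `T⁻¹` has vanishing `(1, 2)` entry, so that `tr (T⁻¹ S)` does not see the entry in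
which `S` and `closestCov S` differ. With `s = ρ₁₃²` and `t = ρ₂₃²`, the Gaussian affinity formula
yields `A⁴ (1 - s - t + ¾ s t)² = (1 - s - t) (1 - s) (1 - t)`, whence `1 - A ≍ s t` as long as
`s + t` stays away from `1`.
-/

namespace MarginalVsConditional

/-! ### Hellinger affinity -/

/-- The Hellinger affinity `∫ √(pq) dμ` of two measures with densities `p`, `q` with respect to the
dominating measure `μ`. Unlike the Hellinger distance it is multiplicative on product measures. -/
noncomputable def hellingerAffinity {X : Type*} [MeasurableSpace X] (μ P Q : Measure X) : ℝ :=
  ∫ x, √((P.rnDeriv μ x).toReal * (Q.rnDeriv μ x).toReal) ∂μ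

section Affinity

variable {X : Type*} [MeasurableSpace X] {μ : Measure X} {f g : X → ℝ}

lemma integrable_sqrt_mul (hf : Integrable f μ) (hg : Integrable g μ) :
    Integrable (fun x => √(f x * g x)) μ := by
  refine (hf.norm.add hg.norm).mono' (by fun_prop) (ae_of_all _ fun x => ?_)
  rw [Real.norm_of_nonneg (Real.sqrt_nonneg _)]
  refine Real.sqrt_le_iff.2 ⟨add_nonneg (norm_nonneg _) (norm_nonneg _), ?_⟩
  calc f x * g x ≤ ‖f x‖ * ‖g x‖ := (Real.le_norm_self _).trans (norm_mul _ _).le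
    _ ≤ (‖f x‖ + ‖g x‖) ^ 2 := by nlinarith [norm_nonneg (f x), norm_nonneg (g x)]

lemma sq_integral_sqrt_mul_le (hf : Integrable f μ) (hg : Integrable g μ) (hf0 : 0 ≤ f)
    (hg0 : 0 ≤ g) : (∫ x, √(f x * g x) ∂μ) ^ 2 ≤ (∫ x, f x ∂μ) * ∫ x, g x ∂μ := by
  have memLp_sqrt {u : X → ℝ} (hu : Integrable u μ) (hu0 : 0 ≤ u) :
      MemLp (fun x => √(u x)) (ENNReal.ofReal 2) μ := by
    rw [ENNReal.ofReal_ofNat, memLp_two_iff_integrable_sq (by fun_prop)]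
    simpa only [Real.sq_sqrt (hu0 _)] using hu
  have hCS := integral_mul_le_Lp_mul_Lq_of_nonneg Real.HolderConjugate.two_two
    (ae_of_all _ fun x => Real.sqrt_nonneg (f x)) (ae_of_all _ fun x => Real.sqrt_nonneg (g x))
    (memLp_sqrt hf hf0) (memLp_sqrt hg hg0)
  simp only [Real.rpow_two, Real.sq_sqrt (hf0 _), Real.sq_sqrt (hg0 _), ← Real.sqrt_eq_rpow,
    ← Real.sqrt_mul (hf0 _)] at hCS
  calc (∫ x, √(f x * g x) ∂μ) ^ 2
      ≤ (√(∫ x, f x ∂μ) * √(∫ x, g x ∂μ)) ^ 2 :=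
        pow_le_pow_left₀ (integral_nonneg fun _ => Real.sqrt_nonneg _) hCS 2
    _ = (∫ x, f x ∂μ) * ∫ x, g x ∂μ := by
        rw [mul_pow, Real.sq_sqrt (integral_nonneg hf0), Real.sq_sqrt (integral_nonneg hg0)]

lemma hellingerSq_eq_one_sub_hellingerAffinity {P Q : Measure X} [SigmaFinite μ]
    [IsProbabilityMeasure P] [IsProbabilityMeasure Q] (hP : P ≪ μ) (hQ : Q ≪ μ) :
    hellingerSq μ P Q = 1 - hellingerAffinity μ P Q := by
  have hexpand (x : X) : (√(P.rnDeriv μ x).toReal - √(Q.rnDeriv μ x).toReal) ^ 2 =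
      (P.rnDeriv μ x).toReal + (Q.rnDeriv μ x).toReal -
        2 * √((P.rnDeriv μ x).toReal * (Q.rnDeriv μ x).toReal) := by
    rw [sub_sq, Real.sq_sqrt ENNReal.toReal_nonneg, Real.sq_sqrt ENNReal.toReal_nonneg,
      Real.sqrt_mul ENNReal.toReal_nonneg]
    ring
  have hp : Integrable (fun x => (P.rnDeriv μ x).toReal) μ := Measure.integrable_toReal_rnDeriv
  have hq : Integrable (fun x => (Q.rnDeriv μ x).toReal) μ := Measure.integrable_toReal_rnDeriv
  simp only [hellingerSq, hellingerAffinity, hexpand]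
  rw [integral_sub (by exact hp.add hq) ((integrable_sqrt_mul hp hq).const_mul 2),
    integral_add hp hq, integral_const_mul, Measure.integral_toReal_rnDeriv hP,
    Measure.integral_toReal_rnDeriv hQ, probReal_univ, probReal_univ]
  ring

lemma hellingerAffinity_le_one {P Q : Measure X} [SigmaFinite μ] [IsProbabilityMeasure P]
    [IsProbabilityMeasure Q] (hP : P ≪ μ) (hQ : Q ≪ μ) : hellingerAffinity μ P Q ≤ 1 := by
  rw [← sub_nonneg, ← hellingerSq_eq_one_sub_hellingerAffinity hP hQ]
  exact mul_nonneg one_half_pos.le (integral_nonneg fun x => sq_nonneg _)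

end Affinity

lemma pi_withDensity_ofReal {ι : Type*} [Fintype ι] {X : ι → Type*} [∀ i, MeasurableSpace (X i)]
    (μ : ∀ i, Measure (X i)) [∀ i, SigmaFinite (μ i)] {f : ∀ i, X i → ℝ}
    (hint : ∀ i, Integrable (f i) (μ i)) (hf : ∀ i x, 0 ≤ f i x) :
    Measure.pi (fun i => (μ i).withDensity fun x => ENNReal.ofReal (f i x)) =
      (Measure.pi μ).withDensity fun x => ENNReal.ofReal (∏ i, f i (x i)) := by
  have (i : ι) : IsFiniteMeasure ((μ i).withDensity fun x => ENNReal.ofReal (f i x)) :=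
    isFiniteMeasure_withDensity_ofReal (hint i).2
  refine Measure.pi_eq fun s hs => ?_
  rw [withDensity_apply _ (MeasurableSet.univ_pi hs), Measure.restrict_pi_pi,
    ← ofReal_integral_eq_lintegral_ofReal
      (Integrable.fintype_prod_dep fun i => (hint i).restrict)
      (ae_of_all _ fun x => Finset.prod_nonneg fun i _ => hf i _),
    integral_fintype_prod_eq_prod,
    ENNReal.ofReal_prod_of_nonneg fun i _ => integral_nonneg (hf i)]
  refine Finset.prod_congr rfl fun i _ => ?_
  rw [withDensity_apply _ (hs i), ofReal_integral_eq_lintegral_ofReal (hint i).restrict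
    (ae_of_all _ (hf i))]

section Pi

variable {ι : Type*} [Fintype ι] {X : ι → Type*} [∀ i, MeasurableSpace (X i)]
  {μ P Q : ∀ i, Measure (X i)} [∀ i, SigmaFinite (μ i)] [∀ i, IsFiniteMeasure (P i)]

lemma pi_eq_withDensity_prod_toReal_rnDeriv (hP : ∀ i, P i ≪ μ i) :
    Measure.pi P = (Measure.pi μ).withDensity
      fun x => ENNReal.ofReal (∏ i, ((P i).rnDeriv (μ i) (x i)).toReal) := by
  have hdens (i : ι) : P i =
      (μ i).withDensity fun x => ENNReal.ofReal ((P i).rnDeriv (μ i) x).toReal := by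
    nth_rw 1 [← Measure.withDensity_rnDeriv_eq _ _ (hP i)]
    refine withDensity_congr_ae ?_
    filter_upwards [(P i).rnDeriv_ne_top (μ i)] with x hx
    rw [ENNReal.ofReal_toReal hx]
  conv_lhs => rw [funext hdens]
  exact pi_withDensity_ofReal μ (fun _ => Measure.integrable_toReal_rnDeriv)
    fun _ _ => ENNReal.toReal_nonneg

lemma pi_absolutelyContinuous (hP : ∀ i, P i ≪ μ i) : Measure.pi P ≪ Measure.pi μ := by
  rw [pi_eq_withDensity_prod_toReal_rnDeriv hP]
  exact withDensity_absolutelyContinuous _ _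

lemma toReal_rnDeriv_pi (hP : ∀ i, P i ≪ μ i) :
    (fun x => ((Measure.pi P).rnDeriv (Measure.pi μ) x).toReal) =ᵐ[Measure.pi μ]
      fun x => ∏ i, ((P i).rnDeriv (μ i) (x i)).toReal := by
  have hmeas : Measurable fun x : ∀ i, X i => ∏ i, ((P i).rnDeriv (μ i) (x i)).toReal := by
    fun_prop
  have hrn := Measure.rnDeriv_withDensity (Measure.pi μ) hmeas.ennreal_ofReal
  rw [← pi_eq_withDensity_prod_toReal_rnDeriv hP] at hrn
  filter_upwards [hrn] with x hx
  rw [hx, ENNReal.toReal_ofReal (by positivity)]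

lemma hellingerAffinity_pi [∀ i, IsFiniteMeasure (Q i)] (hP : ∀ i, P i ≪ μ i)
    (hQ : ∀ i, Q i ≪ μ i) :
    hellingerAffinity (Measure.pi μ) (Measure.pi P) (Measure.pi Q) =
      ∏ i, hellingerAffinity (μ i) (P i) (Q i) := by
  simp only [hellingerAffinity]
  rw [← integral_fintype_prod_eq_prod]
  refine integral_congr_ae ?_
  filter_upwards [toReal_rnDeriv_pi hP, toReal_rnDeriv_pi hQ] with x hPx hQx
  rw [hPx, hQx, ← Finset.prod_mul_distrib, Real.sqrt_prod _ fun i _ => by positivity]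

end Pi

/-! ### Optimal total error -/

section Testing

variable {X : Type*} [MeasurableSpace X]

lemma IsTest.integrable {φ : X → ℝ} (hφ : IsTest φ) (P : Measure X) [IsFiniteMeasure P] :
    Integrable φ P :=
  .of_bound hφ.1.aestronglyMeasurable 1 <| ae_of_all _ fun x => by
    rw [Real.norm_of_nonneg (hφ.2 x).1]
    exact (hφ.2 x).2

lemma IsTest.one_sub {φ : X → ℝ} (hφ : IsTest φ) : IsTest fun x => 1 - φ x :=
  ⟨hφ.1.const_sub 1, fun x => ⟨sub_nonneg.2 (hφ.2 x).2, sub_le_self _ (hφ.2 x).1⟩⟩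

lemma isTest_indicator {A : Set X} (hA : MeasurableSet A) :
    IsTest (A.indicator fun _ => (1 : ℝ)) :=
  ⟨measurable_const.indicator hA, fun x =>
    ⟨Set.indicator_nonneg (fun _ _ => zero_le_one) x,
      Set.indicator_le_self' (fun _ _ => zero_le_one) x⟩⟩

lemma optimalTotalError_nonneg (P Q : Measure X) : 0 ≤ optimalTotalError P Q :=
  Real.iInf_nonneg fun φ => add_nonneg (integral_nonneg fun x => (φ.2.2 x).1)
    (integral_nonneg fun x => (φ.2.one_sub.2 x).1)

lemma optimalTotalError_le {φ : X → ℝ} (hφ : IsTest φ) (P Q : Measure X) :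
    optimalTotalError P Q ≤ (∫ x, φ x ∂P) + ∫ x, (1 - φ x) ∂Q := by
  refine ciInf_le (f := fun φ : {φ : X → ℝ // IsTest φ} =>
    (∫ x, φ.1 x ∂P) + ∫ x, (1 - φ.1 x) ∂Q) ⟨0, ?_⟩ ⟨φ, hφ⟩
  rintro _ ⟨ψ, rfl⟩
  exact add_nonneg (integral_nonneg fun x => (ψ.2.2 x).1)
    (integral_nonneg fun x => (ψ.2.one_sub.2 x).1)

lemma optimalTotalError_le_measureReal_add {A : Set X} (hA : MeasurableSet A) (P Q : Measure X) :
    optimalTotalError P Q ≤ P.real A + Q.real Aᶜ := by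
  have hcompl : (fun x => 1 - A.indicator (fun _ => (1 : ℝ)) x) = Aᶜ.indicator fun _ => 1 :=
    (Set.indicator_compl A fun _ => (1 : ℝ)).symm
  simpa only [hcompl, integral_indicator_const _ hA, integral_indicator_const _ hA.compl,
    smul_eq_mul, mul_one] using optimalTotalError_le (isTest_indicator hA) P Q

lemma optimalTotalError_le_one (P Q : Measure X) [IsProbabilityMeasure Q] :
    optimalTotalError P Q ≤ 1 := by
  simpa using optimalTotalError_le_measureReal_add MeasurableSet.empty P Q

variable {μ P Q : Measure X}

section FiniteMeasure

variable [IsFiniteMeasure P] [IsFiniteMeasure Q]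

lemma integrable_min_toReal_rnDeriv :
    Integrable (fun x => min (P.rnDeriv μ x).toReal (Q.rnDeriv μ x).toReal) μ :=
  Measure.integrable_toReal_rnDeriv.inf Measure.integrable_toReal_rnDeriv

variable [SigmaFinite μ]

lemma integral_min_rnDeriv_le {φ : X → ℝ} (hφ : IsTest φ) (hP : P ≪ μ) (hQ : Q ≪ μ) :
    ∫ x, min (P.rnDeriv μ x).toReal (Q.rnDeriv μ x).toReal ∂μ ≤
      (∫ x, φ x ∂P) + ∫ x, (1 - φ x) ∂Q := by
  have hp : Integrable (fun x => (P.rnDeriv μ x).toReal * φ x) μ :=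
    (integrable_rnDeriv_smul_iff hP).2 (hφ.integrable P)
  have hq : Integrable (fun x => (Q.rnDeriv μ x).toReal * (1 - φ x)) μ :=
    (integrable_rnDeriv_smul_iff hQ).2 (hφ.one_sub.integrable Q)
  simp only [← integral_rnDeriv_smul hP, ← integral_rnDeriv_smul hQ, smul_eq_mul]
  rw [← integral_add hp hq]
  refine integral_mono integrable_min_toReal_rnDeriv (hp.add hq) fun x => ?_
  obtain ⟨hφ0, hφ1⟩ := hφ.2 x
  set p := (P.rnDeriv μ x).toReal
  set q := (Q.rnDeriv μ x).toReal
  calc min p q = min p q * φ x + min p q * (1 - φ x) := by ring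
    _ ≤ p * φ x + q * (1 - φ x) := by
      gcongr
      · exact min_le_left _ _
      · exact min_le_right _ _

lemma measureReal_rnDeriv_le_add_compl (hP : P ≪ μ) (hQ : Q ≪ μ) :
    P.real {x | (P.rnDeriv μ x).toReal ≤ (Q.rnDeriv μ x).toReal} +
        Q.real {x | (P.rnDeriv μ x).toReal ≤ (Q.rnDeriv μ x).toReal}ᶜ =
      ∫ x, min (P.rnDeriv μ x).toReal (Q.rnDeriv μ x).toReal ∂μ := by
  set A := {x | (P.rnDeriv μ x).toReal ≤ (Q.rnDeriv μ x).toReal}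
  have hA : MeasurableSet A := measurableSet_le (by fun_prop) (by fun_prop)
  rw [← integral_add_compl hA integrable_min_toReal_rnDeriv,
    ← Measure.setIntegral_toReal_rnDeriv hP, ← Measure.setIntegral_toReal_rnDeriv hQ]
  congr 1
  · exact setIntegral_congr_fun hA fun x hx => (min_eq_left hx).symm
  · exact setIntegral_congr_fun hA.compl fun x (hx : ¬ _ ≤ _) =>
      (min_eq_right (le_of_not_ge hx)).symm

lemma optimalTotalError_eq_integral_min_rnDeriv (hP : P ≪ μ) (hQ : Q ≪ μ) :
    optimalTotalError P Q = ∫ x, min (P.rnDeriv μ x).toReal (Q.rnDeriv μ x).toReal ∂μ := by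
  have : Nonempty {φ : X → ℝ // IsTest φ} := ⟨⟨_, isTest_indicator MeasurableSet.empty⟩⟩
  refine le_antisymm ?_ (le_ciInf fun φ => integral_min_rnDeriv_le φ.2 hP hQ)
  rw [← measureReal_rnDeriv_le_add_compl hP hQ]
  exact optimalTotalError_le_measureReal_add (measurableSet_le (by fun_prop) (by fun_prop)) P Q

lemma exists_measureReal_add_compl_eq_optimalTotalError (P Q : Measure X) [IsFiniteMeasure P]
    [IsFiniteMeasure Q] :
    ∃ A, MeasurableSet A ∧ P.real A + Q.real Aᶜ = optimalTotalError P Q := by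
  have hP : P ≪ P + Q := Measure.AbsolutelyContinuous.rfl.add_right Q
  have hQ : Q ≪ P + Q := by rw [add_comm]; exact Measure.AbsolutelyContinuous.rfl.add_right P
  refine ⟨_, measurableSet_le (by fun_prop) (by fun_prop),
    (measureReal_rnDeriv_le_add_compl hP hQ).trans ?_⟩
  exact (optimalTotalError_eq_integral_min_rnDeriv hP hQ).symm

lemma optimalTotalError_le_hellingerAffinity (hP : P ≪ μ) (hQ : Q ≪ μ) :
    optimalTotalError P Q ≤ hellingerAffinity μ P Q := by
  rw [optimalTotalError_eq_integral_min_rnDeriv hP hQ]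
  refine integral_mono integrable_min_toReal_rnDeriv
    (integrable_sqrt_mul Measure.integrable_toReal_rnDeriv Measure.integrable_toReal_rnDeriv)
    fun x => Real.le_sqrt_of_sq_le ?_
  rw [sq]
  exact mul_le_mul (min_le_left _ _) (min_le_right _ _) (by positivity) (by positivity)

end FiniteMeasure

/-- By Cauchy–Schwarz, since `∫ min p q + ∫ max p q = 2`. -/
lemma sq_hellingerAffinity_le [SigmaFinite μ] [IsProbabilityMeasure P]
    [IsProbabilityMeasure Q] (hP : P ≪ μ) (hQ : Q ≪ μ) :
    hellingerAffinity μ P Q ^ 2 ≤ optimalTotalError P Q * (2 - optimalTotalError P Q) := by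
  rw [optimalTotalError_eq_integral_min_rnDeriv hP hQ]
  set p := fun x => (P.rnDeriv μ x).toReal
  set q := fun x => (Q.rnDeriv μ x).toReal
  have hp : Integrable p μ := Measure.integrable_toReal_rnDeriv
  have hq : Integrable q μ := Measure.integrable_toReal_rnDeriv
  have hp0 : 0 ≤ p := fun _ => ENNReal.toReal_nonneg
  have hq0 : 0 ≤ q := fun _ => ENNReal.toReal_nonneg
  have hmin : Integrable (fun x => min (p x) (q x)) μ := hp.inf hq
  have hmax : Integrable (fun x => max (p x) (q x)) μ := hp.sup hq
  have hsum : (∫ x, min (p x) (q x) ∂μ) + ∫ x, max (p x) (q x) ∂μ = 2 := by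
    rw [← integral_add hmin hmax]
    simp_rw [min_add_max]
    rw [integral_add hp hq, Measure.integral_toReal_rnDeriv hP,
      Measure.integral_toReal_rnDeriv hQ, probReal_univ, probReal_univ, one_add_one_eq_two]
  calc hellingerAffinity μ P Q ^ 2
      = (∫ x, √(min (p x) (q x) * max (p x) (q x)) ∂μ) ^ 2 := by
        simp_rw [min_mul_max]; rfl
    _ ≤ (∫ x, min (p x) (q x) ∂μ) * ∫ x, max (p x) (q x) ∂μ :=
        sq_integral_sqrt_mul_le hmin hmax (fun x => le_min (hp0 x) (hq0 x))
          fun x => (hp0 x).trans (le_max_left _ _)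
    _ = (∫ x, min (p x) (q x) ∂μ) * (2 - ∫ x, min (p x) (q x) ∂μ) := by
        rw [eq_sub_of_add_eq' hsum]

end Testing

lemma consistentSelection_iff_tendsto_optimalTotalError {X : ℕ → Type*}
    [∀ k, MeasurableSpace (X k)] (P Q : ∀ k, Measure (X k)) [∀ k, IsFiniteMeasure (P k)]
    [∀ k, IsFiniteMeasure (Q k)] :
    ConsistentSelection P Q ↔
      Tendsto (fun k => optimalTotalError (P k) (Q k)) atTop (𝓝 0) := by
  have hreal {R : ∀ k, Measure (X k)} [∀ k, IsFiniteMeasure (R k)] (A : ∀ k, Set (X k)) :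
      Tendsto (fun k => R k (A k)) atTop (𝓝 0) ↔ Tendsto (fun k => (R k).real (A k)) atTop (𝓝 0) :=
    (ENNReal.tendsto_toReal_iff (fun k => measure_ne_top _ _) ENNReal.zero_ne_top).symm
  simp only [ConsistentSelection, hreal]
  constructor
  · rintro ⟨A, hA, hP, hQ⟩
    exact squeeze_zero (fun k => optimalTotalError_nonneg _ _)
      (fun k => optimalTotalError_le_measureReal_add (hA k) _ _) (by simpa using hP.add hQ)
  · intro he
    choose A hA hAe using fun k => exists_measureReal_add_compl_eq_optimalTotalError (P k) (Q k)
    refine ⟨A, hA, squeeze_zero (fun k => measureReal_nonneg) (fun k => ?_) he,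
      squeeze_zero (fun k => measureReal_nonneg) (fun k => ?_) he⟩
    · exact (le_add_of_nonneg_right measureReal_nonneg).trans_eq (hAe k)
    · exact (le_add_of_nonneg_left measureReal_nonneg).trans_eq (hAe k)

/-! ### Rates -/

section Rates

variable {α : Type*} {l : Filter α}

lemma isTheta_neg_log_one_sub {b : α → ℝ} {β : ℝ} (hβ : 0 < β) (hb : ∀ᶠ k in l, β ≤ b k)
    (hb1 : ∀ᶠ k in l, b k ≤ 1) : (fun k => -Real.log (b k)) =Θ[l] fun k => 1 - b k := by
  refine ⟨.of_bound β⁻¹ ?_, .of_bound 1 ?_⟩ <;> filter_upwards [hb, hb1] with k hk hk1 <;>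
    have hpos := hβ.trans_le hk <;>
    rw [Real.norm_of_nonneg (neg_nonneg.2 (Real.log_nonpos hpos.le hk1)),
      Real.norm_of_nonneg (sub_nonneg.2 hk1)]
  · calc -Real.log (b k) ≤ (b k)⁻¹ - 1 := by linarith [Real.one_sub_inv_le_log_of_pos hpos]
      _ = (b k)⁻¹ * (1 - b k) := by field_simp
      _ ≤ β⁻¹ * (1 - b k) := by gcongr
  · linarith [Real.log_le_sub_one_of_pos hpos]

lemma one_isLittleO_mul_iff {u h : α → ℝ} (hh : ∀ᶠ k in l, h k ≠ 0) :
    (fun _ => (1 : ℝ)) =o[l] (fun k => u k * h k) ↔ (fun k => 1 / h k) =o[l] u := by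
  refine ⟨fun H => (H.mul_isBigO (isBigO_refl (fun k => 1 / h k) l)).congr' ?_ ?_,
    fun H => (H.mul_isBigO (isBigO_refl h l)).congr' ?_ .rfl⟩
  · exact .of_forall fun k => one_mul _
  · filter_upwards [hh] with k hk using by field_simp
  · filter_upwards [hh] with k hk using one_div_mul_cancel hk

lemma isTheta_one_div_iff {u h : α → ℝ} (hh : ∀ᶠ k in l, h k ≠ 0) :
    u =Θ[l] (fun k => 1 / h k) ↔ (fun k => u k * h k) =Θ[l] fun _ => (1 : ℝ) := by
  refine ⟨fun H => (H.mul (isTheta_refl h l)).trans_eventuallyEq ?_,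
    fun H => EventuallyEq.trans_isTheta ?_ (H.div (isTheta_refl h l))⟩
  · filter_upwards [hh] with k hk using one_div_mul_cancel hk
  · filter_upwards [hh] with k hk using (mul_div_cancel_right₀ _ hk).symm

lemma isTheta_one_iff {x : α → ℝ} (hx : ∀ᶠ k in l, 0 ≤ x k) :
    x =Θ[l] (fun _ => (1 : ℝ)) ↔ ∃ a > 0, ∃ b, ∀ᶠ k in l, a ≤ x k ∧ x k ≤ b := by
  constructor
  · rintro ⟨hupper, hlower⟩
    obtain ⟨b, hb⟩ := hupper.bound
    obtain ⟨a, ha, hab⟩ := (isBigO_const_left_iff_pos_le_norm one_ne_zero).1 hlower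
    refine ⟨a, ha, b, ?_⟩
    filter_upwards [hx, hb, hab] with k hk hkb hka
    rw [Real.norm_of_nonneg hk] at hkb hka
    exact ⟨hka, by simpa using hkb⟩
  · rintro ⟨a, ha, b, hab⟩
    refine ⟨.of_bound b ?_, (isBigO_const_left_iff_pos_le_norm one_ne_zero).2 ⟨a, ha, ?_⟩⟩ <;>
      filter_upwards [hx, hab] with k hk hkab <;> rw [Real.norm_of_nonneg hk]
    · simpa using hkab.2
    · exact hkab.1

lemma liminf_pos_and_limsup_lt_one_iff [l.NeBot] {e : α → ℝ} (he0 : ∀ k, 0 ≤ e k)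
    (he1 : ∀ k, e k ≤ 1) :
    (0 < liminf e l ∧ limsup e l < 1) ↔ ∃ a > 0, ∃ b < 1, ∀ᶠ k in l, a ≤ e k ∧ e k ≤ b := by
  have hle : IsBoundedUnder (· ≤ ·) l e := isBoundedUnder_of ⟨1, he1⟩
  have hge : IsBoundedUnder (· ≥ ·) l e := isBoundedUnder_of ⟨0, he0⟩
  constructor
  · rintro ⟨h0, h1⟩
    obtain ⟨a, ha0, ha⟩ := exists_between h0
    obtain ⟨b, hb, hb1⟩ := exists_between h1
    refine ⟨a, ha0, b, hb1, ?_⟩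
    filter_upwards [eventually_lt_of_lt_liminf ha hge, eventually_lt_of_limsup_lt hb hle]
      with k hak hkb using ⟨hak.le, hkb.le⟩
  · rintro ⟨a, ha, b, hb, hab⟩
    exact ⟨ha.trans_le (le_liminf_of_le hle.isCoboundedUnder_ge (hab.mono fun k hk => hk.1)),
      (limsup_le_of_le hge.isCoboundedUnder_le (hab.mono fun k hk => hk.2)).trans_lt hb⟩

variable {e x : α → ℝ} (hu : ∀ᶠ k in l, e k ≤ Real.exp (-x k))
  (hl : ∀ᶠ k in l, Real.exp (-(2 * x k)) ≤ e k * (2 - e k))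
include hu hl

lemma tendsto_nhds_zero_iff_of_exp_bounds (he0 : ∀ k, 0 ≤ e k) :
    Tendsto e l (𝓝 0) ↔ Tendsto x l atTop := by
  refine ⟨fun he => ?_, fun hx => ?_⟩
  · have hzero : Tendsto (fun k => Real.exp (-(2 * x k))) l (𝓝 0) := by
      refine squeeze_zero' (.of_forall fun k => (Real.exp_pos _).le) hl ?_
      simpa using he.mul (he.const_sub 2)
    rw [Real.tendsto_exp_comp_nhds_zero, tendsto_neg_atBot_iff] at hzero
    exact (tendsto_const_mul_atTop_of_pos two_pos).1 hzero
  · refine squeeze_zero' (.of_forall he0) hu ?_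
    rwa [Real.tendsto_exp_comp_nhds_zero, tendsto_neg_atBot_iff]

lemma exists_bounds_iff_of_exp_bounds [l.NeBot] :
    (∃ a > 0, ∃ b < 1, ∀ᶠ k in l, a ≤ e k ∧ e k ≤ b) ↔
      ∃ a > 0, ∃ b, ∀ᶠ k in l, a ≤ x k ∧ x k ≤ b := by
  constructor
  · rintro ⟨a, ha, b, hb, hab⟩
    obtain ⟨k, hk⟩ := hab.exists
    have hb0 : 0 < b := ha.trans_le (hk.1.trans hk.2)
    have hc0 : 0 < b * (2 - b) := mul_pos hb0 (by linarith)
    have hc1 : b * (2 - b) < 1 := by nlinarith [mul_pos (sub_pos.2 hb) (sub_pos.2 hb)]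
    refine ⟨-Real.log (b * (2 - b)) / 2, half_pos (neg_pos.2 (Real.log_neg hc0 hc1)),
      -Real.log a, ?_⟩
    filter_upwards [hab, hu, hl] with k hk huk hlk
    have hlower : -(2 * x k) ≤ Real.log (b * (2 - b)) :=
      (Real.le_log_iff_exp_le hc0).2 (hlk.trans (by nlinarith))
    have hupper : Real.log a ≤ -x k := (Real.log_le_iff_le_exp ha).2 (hk.1.trans huk)
    exact ⟨by linarith, by linarith⟩
  · rintro ⟨a, ha, b, hab⟩
    refine ⟨Real.exp (-(2 * b)) / 2, by positivity, Real.exp (-a),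
      Real.exp_lt_one_iff.2 (neg_lt_zero.2 ha), ?_⟩
    filter_upwards [hab, hu, hl] with k hk huk hlk
    have hlower : Real.exp (-(2 * b)) ≤ Real.exp (-(2 * x k)) := by gcongr; exact hk.2
    have hupper : Real.exp (-x k) ≤ Real.exp (-a) := by gcongr; exact hk.1
    exact ⟨by nlinarith [sq_nonneg (e k)], huk.trans hupper⟩

end Rates

section Pi

variable {X : Type*} [MeasurableSpace X] {μ P Q : Measure X} [SigmaFinite μ]
  [IsProbabilityMeasure P] [IsProbabilityMeasure Q]

lemma optimalTotalError_pi_bounds (hP : P ≪ μ) (hQ : Q ≪ μ) (hpos : 0 < hellingerAffinity μ P Q)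
    (n : ℕ) :
    optimalTotalError (Measure.pi fun _ : Fin n => P) (Measure.pi fun _ => Q) ≤
        Real.exp (-(n * -Real.log (hellingerAffinity μ P Q))) ∧
      Real.exp (-(2 * (n * -Real.log (hellingerAffinity μ P Q)))) ≤
        optimalTotalError (Measure.pi fun _ : Fin n => P) (Measure.pi fun _ => Q) *
          (2 - optimalTotalError (Measure.pi fun _ : Fin n => P) (Measure.pi fun _ => Q)) := by
  have hPn : (Measure.pi fun _ : Fin n => P) ≪ Measure.pi fun _ => μ :=
    pi_absolutelyContinuous fun _ => hP
  have hQn : (Measure.pi fun _ : Fin n => Q) ≪ Measure.pi fun _ => μ :=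
    pi_absolutelyContinuous fun _ => hQ
  have hpow : hellingerAffinity (Measure.pi fun _ : Fin n => μ) (Measure.pi fun _ => P)
      (Measure.pi fun _ => Q) = Real.exp (-(n * -Real.log (hellingerAffinity μ P Q))) := by
    rw [hellingerAffinity_pi (fun _ => hP) fun _ => hQ, Fin.prod_const, mul_neg, neg_neg,
      Real.exp_nat_mul, Real.exp_log hpos]
  constructor
  · rw [← hpow]
    exact optimalTotalError_le_hellingerAffinity hPn hQn
  · calc Real.exp (-(2 * (n * -Real.log (hellingerAffinity μ P Q))))
        = hellingerAffinity (Measure.pi fun _ : Fin n => μ) (Measure.pi fun _ => P)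
            (Measure.pi fun _ => Q) ^ 2 := by
          rw [hpow, ← Real.exp_nat_mul]
          push_cast
          ring_nf
      _ ≤ _ := sq_hellingerAffinity_le hPn hQn

end Pi

section SequenceOfPairs

variable {α : Type*} {l : Filter α} {X : α → Type*} [∀ k, MeasurableSpace (X k)]
  {μ P Q : ∀ k, Measure (X k)} [∀ k, SigmaFinite (μ k)] [∀ k, IsProbabilityMeasure (P k)]
  [∀ k, IsProbabilityMeasure (Q k)] {β : ℝ}

lemma isTheta_neg_log_hellingerAffinity (hP : ∀ k, P k ≪ μ k) (hQ : ∀ k, Q k ≪ μ k) (hβ : β < 1)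
    (hH : ∀ᶠ k in l, hellingerSq (μ k) (P k) (Q k) ≤ β) :
    (fun k => -Real.log (hellingerAffinity (μ k) (P k) (Q k))) =Θ[l]
      fun k => hellingerSq (μ k) (P k) (Q k) := by
  have hsq (k : α) := hellingerSq_eq_one_sub_hellingerAffinity (hP k) (hQ k)
  simp only [hsq] at hH ⊢
  exact isTheta_neg_log_one_sub (sub_pos.2 hβ) (hH.mono fun k hk => by linarith)
    (.of_forall fun k => hellingerAffinity_le_one (hP k) (hQ k))

lemma eventually_optimalTotalError_pi_bounds (hP : ∀ k, P k ≪ μ k) (hQ : ∀ k, Q k ≪ μ k)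
    (hβ : β < 1) (hH : ∀ᶠ k in l, hellingerSq (μ k) (P k) (Q k) ≤ β) (n : α → ℕ) :
    ∀ᶠ k in l, 0 ≤ n k * -Real.log (hellingerAffinity (μ k) (P k) (Q k)) ∧
      optimalTotalError (Measure.pi fun _ : Fin (n k) => P k) (Measure.pi fun _ => Q k) ≤
        Real.exp (-(n k * -Real.log (hellingerAffinity (μ k) (P k) (Q k)))) ∧
      Real.exp (-(2 * (n k * -Real.log (hellingerAffinity (μ k) (P k) (Q k))))) ≤
        optimalTotalError (Measure.pi fun _ : Fin (n k) => P k) (Measure.pi fun _ => Q k) * (2 -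
          optimalTotalError (Measure.pi fun _ : Fin (n k) => P k) (Measure.pi fun _ => Q k)) := by
  filter_upwards [hH] with k hk
  rw [hellingerSq_eq_one_sub_hellingerAffinity (hP k) (hQ k)] at hk
  have hpos : 0 < hellingerAffinity (μ k) (P k) (Q k) := by linarith
  exact ⟨mul_nonneg (Nat.cast_nonneg _) <| neg_nonneg.2 <|
    Real.log_nonpos hpos.le (hellingerAffinity_le_one (hP k) (hQ k)),
    optimalTotalError_pi_bounds (hP k) (hQ k) hpos (n k)⟩

variable {h : α → ℝ}

lemma tendsto_optimalTotalError_pi_iff (hP : ∀ k, P k ≪ μ k) (hQ : ∀ k, Q k ≪ μ k) (hβ : β < 1)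
    (hH : ∀ᶠ k in l, hellingerSq (μ k) (P k) (Q k) ≤ β)
    (hΘ : (fun k => hellingerSq (μ k) (P k) (Q k)) =Θ[l] h) (hh : ∀ᶠ k in l, h k ≠ 0)
    (n : α → ℕ) :
    Tendsto (fun k => optimalTotalError (Measure.pi fun _ : Fin (n k) => P k)
      (Measure.pi fun _ => Q k)) l (𝓝 0) ↔ (fun k => 1 / h k) =o[l] fun k => (n k : ℝ) := by
  have hbounds := eventually_optimalTotalError_pi_bounds hP hQ hβ hH n
  have hx : (fun k => n k * -Real.log (hellingerAffinity (μ k) (P k) (Q k))) =Θ[l]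
      fun k => n k * h k :=
    (isTheta_refl _ l).mul ((isTheta_neg_log_hellingerAffinity hP hQ hβ hH).trans hΘ)
  rw [tendsto_nhds_zero_iff_of_exp_bounds (hbounds.mono fun k hk => hk.2.1)
    (hbounds.mono fun k hk => hk.2.2) fun k => optimalTotalError_nonneg _ _,
    ← one_isLittleO_mul_iff hh, ← hx.isLittleO_congr_right, isLittleO_one_left_iff]
  refine tendsto_congr' (hbounds.mono fun k hk => (Real.norm_of_nonneg hk.1).symm)

lemma liminf_limsup_optimalTotalError_pi_iff [l.NeBot] (hP : ∀ k, P k ≪ μ k)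
    (hQ : ∀ k, Q k ≪ μ k) (hβ : β < 1) (hH : ∀ᶠ k in l, hellingerSq (μ k) (P k) (Q k) ≤ β)
    (hΘ : (fun k => hellingerSq (μ k) (P k) (Q k)) =Θ[l] h) (hh : ∀ᶠ k in l, h k ≠ 0)
    (n : α → ℕ) :
    (0 < liminf (fun k => optimalTotalError (Measure.pi fun _ : Fin (n k) => P k)
          (Measure.pi fun _ => Q k)) l ∧
        limsup (fun k => optimalTotalError (Measure.pi fun _ : Fin (n k) => P k)
          (Measure.pi fun _ => Q k)) l < 1) ↔
      (fun k => (n k : ℝ)) =Θ[l] fun k => 1 / h k := by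
  have hbounds := eventually_optimalTotalError_pi_bounds hP hQ hβ hH n
  have hx : (fun k => n k * -Real.log (hellingerAffinity (μ k) (P k) (Q k))) =Θ[l]
      fun k => n k * h k :=
    (isTheta_refl _ l).mul ((isTheta_neg_log_hellingerAffinity hP hQ hβ hH).trans hΘ)
  rw [liminf_pos_and_limsup_lt_one_iff (fun k => optimalTotalError_nonneg _ _)
      fun k => optimalTotalError_le_one _ _,
    exists_bounds_iff_of_exp_bounds (hbounds.mono fun k hk => hk.2.1)
      (hbounds.mono fun k hk => hk.2.2),
    isTheta_one_div_iff hh, ← hx.isTheta_congr_left,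
    isTheta_one_iff (hbounds.mono fun k hk => hk.1)]

end SequenceOfPairs

/-! ### Gaussian densities -/

lemma map_withDensity_comp {X Y : Type*} [MeasurableSpace X] [MeasurableSpace Y] (μ : Measure X)
    {f : Y → ℝ≥0∞} {g : X → Y} (hf : Measurable f) (hg : Measurable g) :
    (μ.withDensity (f ∘ g)).map g = (μ.map g).withDensity f := by
  refine Measure.ext fun s hs => ?_
  rw [Measure.map_apply hg hs, withDensity_apply _ (hg hs), withDensity_apply _ hs,
    setLIntegral_map hs hf hg]
  rfl

section Gaussian

open Matrix WithLp
open scoped MatrixOrder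

variable {ι : Type*} [Fintype ι] [DecidableEq ι] {S T R : Matrix ι ι ℝ}

/-- The Lebesgue density of the centred Gaussian law with covariance matrix `S`, for `S` positive
definite. -/
noncomputable def gaussianDensity (S : Matrix ι ι ℝ) (x : EuclideanSpace ℝ ι) : ℝ :=
  (√((2 * Real.pi) ^ Fintype.card ι * S.det))⁻¹ *
    Real.exp (-(ofLp x ⬝ᵥ S⁻¹ *ᵥ ofLp x) / 2)

lemma gaussianDensity_pos (hS : S.PosDef) (x : EuclideanSpace ℝ ι) : 0 < gaussianDensity S x := by
  have := hS.det_pos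
  unfold gaussianDensity
  positivity

lemma continuous_gaussianDensity (S : Matrix ι ι ℝ) : Continuous (gaussianDensity S) := by
  unfold gaussianDensity dotProduct mulVec dotProduct
  fun_prop

lemma log_gaussianDensity (hS : S.PosDef) (x : EuclideanSpace ℝ ι) :
    Real.log (gaussianDensity S x) =
      -(Fintype.card ι * Real.log (2 * Real.pi) + Real.log S.det +
        ofLp x ⬝ᵥ S⁻¹ *ᵥ ofLp x) / 2 := by
  have := hS.det_pos
  rw [gaussianDensity, Real.log_mul (by positivity) (Real.exp_pos _).ne', Real.log_exp,
    Real.log_inv, Real.log_sqrt (by positivity), Real.log_mul (by positivity) this.ne',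
    Real.log_pow]
  ring

lemma gaussianDensity_one_eq_prod (x : ι → ℝ) :
    gaussianDensity (1 : Matrix ι ι ℝ) (toLp 2 x) = ∏ i, gaussianPDFReal 0 1 (x i) := by
  simp only [gaussianPDFReal, gaussianDensity, Finset.prod_mul_distrib, ← Real.exp_sum]
  congr 1
  · simp [Real.sqrt_eq_rpow, ← Real.rpow_natCast, ← Real.rpow_mul, Real.pi_nonneg, mul_comm]
  · simp [dotProduct, Finset.sum_div, neg_div, sq]

lemma stdGaussian_eq_withDensity :
    stdGaussian (EuclideanSpace ℝ ι) =
      volume.withDensity fun x => ENNReal.ofReal (gaussianDensity (1 : Matrix ι ι ℝ) x) := by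
  have hmeas : Measurable fun x : EuclideanSpace ℝ ι =>
      ENNReal.ofReal (gaussianDensity (1 : Matrix ι ι ℝ) x) :=
    (continuous_gaussianDensity 1).measurable.ennreal_ofReal
  have hmap := map_withDensity_comp volume hmeas (PiLp.volume_preserving_toLp ι).measurable
  rw [(PiLp.volume_preserving_toLp ι).map_eq] at hmap
  rw [← map_pi_eq_stdGaussian, gaussianReal_of_var_ne_zero 0 one_ne_zero, ← hmap]
  unfold gaussianPDF
  rw [pi_withDensity_ofReal _ (fun _ => integrable_gaussianPDFReal 0 1)
    (fun _ => gaussianPDFReal_nonneg 0 1), ← volume_pi]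
  simp_rw [← gaussianDensity_one_eq_prod]
  rfl

lemma map_toEuclideanCLM_volume (hR : R.det ≠ 0) :
    (volume : Measure (EuclideanSpace ℝ ι)).map (toEuclideanCLM (𝕜 := ℝ) R) =
      ENNReal.ofReal |R.det⁻¹| • volume := by
  have hdet : LinearMap.det (toEuclideanLin R) = R.det := by
    rw [toEuclideanLin_eq_toLin_orthonormal, LinearMap.det_toLin]
  rw [← hdet] at hR ⊢
  exact Measure.map_linearMap_addHaar_eq_smul_addHaar volume hR

lemma gaussianDensity_one_eq (hR : R.det ≠ 0) (x : EuclideanSpace ℝ ι) :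
    gaussianDensity (1 : Matrix ι ι ℝ) x =
      |R.det| * gaussianDensity (R * Rᵀ) (toEuclideanCLM (𝕜 := ℝ) R x) := by
  have hquad : ofLp (toEuclideanCLM (𝕜 := ℝ) R x) ⬝ᵥ
      (R * Rᵀ)⁻¹ *ᵥ ofLp (toEuclideanCLM (𝕜 := ℝ) R x) = ofLp x ⬝ᵥ ofLp x := by
    rw [ofLp_toEuclideanCLM, Matrix.mul_inv_rev, mulVec_mulVec, mul_assoc,
      nonsing_inv_mul _ hR.isUnit, mul_one, dotProduct_mulVec, vecMul_mulVec,
      mul_nonsing_inv _ (by rwa [det_transpose, isUnit_iff_ne_zero])]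
    simp
  have := abs_pos.2 hR
  rw [gaussianDensity, gaussianDensity, hquad, det_mul, det_transpose,
    Real.sqrt_mul (by positivity) (R.det * R.det), Real.sqrt_mul_self_eq_abs, det_one, inv_one,
    one_mulVec, mul_one]
  field_simp

lemma map_stdGaussian_toEuclideanCLM (hR : R.det ≠ 0) :
    (stdGaussian (EuclideanSpace ℝ ι)).map (toEuclideanCLM (𝕜 := ℝ) R) =
      volume.withDensity fun x => ENNReal.ofReal (gaussianDensity (R * Rᵀ) x) := by
  set f := fun x => ENNReal.ofReal (gaussianDensity (R * Rᵀ) x)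
  have hfm : Measurable f := (continuous_gaussianDensity _).measurable.ennreal_ofReal
  have hLm : Measurable (toEuclideanCLM (𝕜 := ℝ) R) := ContinuousLinearMap.measurable _
  have hdens : (fun x => ENNReal.ofReal (gaussianDensity (1 : Matrix ι ι ℝ) x)) =
      ENNReal.ofReal |R.det| • (f ∘ toEuclideanCLM (𝕜 := ℝ) R) := by
    ext x
    rw [gaussianDensity_one_eq hR, ENNReal.ofReal_mul (abs_nonneg _)]
    rfl
  rw [stdGaussian_eq_withDensity, hdens, withDensity_smul _ (hfm.comp hLm), Measure.map_smul,
    map_withDensity_comp _ hfm hLm, map_toEuclideanCLM_volume hR, withDensity_smul_measure,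
    smul_smul, ← ENNReal.ofReal_mul (abs_nonneg _), ← abs_mul, mul_inv_cancel₀ hR, abs_one,
    ENNReal.ofReal_one, one_smul]

theorem multivariateGaussian_zero_eq_withDensity (hS : S.PosDef) :
    multivariateGaussian 0 S =
      volume.withDensity fun x => ENNReal.ofReal (gaussianDensity S x) := by
  have hsqrt : CFC.sqrt S * (CFC.sqrt S)ᵀ = S := by
    have hsymm : (CFC.sqrt S)ᵀ = CFC.sqrt S := by
      simpa using (CFC.sqrt_nonneg S).posSemidef.isHermitian.eq
    rw [hsymm, CFC.sqrt_mul_sqrt_self _ hS.posSemidef.nonneg]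
  have hdet : (CFC.sqrt S).det ≠ 0 := fun h =>
    hS.det_pos.ne' (by rw [← hsqrt, det_mul, h, zero_mul])
  simp only [multivariateGaussian, zero_add]
  rw [map_stdGaussian_toEuclideanCLM hdet, hsqrt]

lemma multivariateGaussian_absolutelyContinuous_volume (hS : S.PosDef) :
    multivariateGaussian 0 S ≪ volume := by
  rw [multivariateGaussian_zero_eq_withDensity hS]
  exact withDensity_absolutelyContinuous _ _

lemma volume_absolutelyContinuous_multivariateGaussian (hS : S.PosDef) :
    volume ≪ multivariateGaussian 0 S := by
  rw [multivariateGaussian_zero_eq_withDensity hS]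
  exact withDensity_absolutelyContinuous'
    (continuous_gaussianDensity S).measurable.ennreal_ofReal.aemeasurable
    (ae_of_all _ fun x => (ENNReal.ofReal_pos.2 (gaussianDensity_pos hS x)).ne')

lemma toReal_rnDeriv_multivariateGaussian (hS : S.PosDef) :
    (fun x => ((multivariateGaussian 0 S).rnDeriv volume x).toReal) =ᵐ[volume]
      gaussianDensity S := by
  have hrn := Measure.rnDeriv_withDensity volume
    (continuous_gaussianDensity S).measurable.ennreal_ofReal
  rw [← multivariateGaussian_zero_eq_withDensity hS] at hrn
  filter_upwards [hrn] with x hx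
  rw [hx, ENNReal.toReal_ofReal (gaussianDensity_pos hS x).le]

lemma integral_gaussianDensity (hS : S.PosDef) : ∫ x, gaussianDensity S x = 1 := by
  rw [← integral_congr_ae (toReal_rnDeriv_multivariateGaussian hS),
    Measure.integral_toReal_rnDeriv (multivariateGaussian_absolutelyContinuous_volume hS),
    probReal_univ]

lemma integral_exp_neg_dotProduct_mulVec (hS : S.PosDef) :
    ∫ x : EuclideanSpace ℝ ι, Real.exp (-(ofLp x ⬝ᵥ S *ᵥ ofLp x) / 2) =
      √((2 * Real.pi) ^ Fintype.card ι / S.det) := by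
  have hpos := hS.det_pos
  have hint := integral_gaussianDensity hS.inv
  simp only [gaussianDensity, nonsing_inv_nonsing_inv _ hpos.ne'.isUnit] at hint
  rw [integral_const_mul, det_nonsing_inv, Ring.inverse_eq_inv', ← div_eq_mul_inv] at hint
  exact (eq_of_inv_mul_eq_one hint).symm

/-! ### The Hellinger affinity of two Gaussian laws -/

lemma det_half_inv_add_inv (hS : S.det ≠ 0) (hT : T.det ≠ 0) :
    S.det * ((1 / 2 : ℝ) • (S⁻¹ + T⁻¹)).det * T.det = ((1 / 2 : ℝ) • (S + T)).det := by
  rw [← det_mul, ← det_mul, mul_smul_comm, smul_mul_assoc, mul_add, add_mul,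
    mul_nonsing_inv _ hS.isUnit, one_mul, mul_assoc, nonsing_inv_mul _ hT.isUnit, mul_one,
    add_comm]

lemma sqrt_gaussianDensity_mul (S T : Matrix ι ι ℝ) (x : EuclideanSpace ℝ ι) :
    √(gaussianDensity S x * gaussianDensity T x) =
      √((√((2 * Real.pi) ^ Fintype.card ι * S.det))⁻¹ *
        (√((2 * Real.pi) ^ Fintype.card ι * T.det))⁻¹) *
      Real.exp (-(ofLp x ⬝ᵥ ((1 / 2 : ℝ) • (S⁻¹ + T⁻¹)) *ᵥ ofLp x) / 2) := by
  rw [gaussianDensity, gaussianDensity, mul_mul_mul_comm, Real.sqrt_mul (by positivity),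
    ← Real.exp_add, ← Real.exp_half]
  congr 2
  rw [smul_mulVec, add_mulVec, dotProduct_smul, dotProduct_add, smul_eq_mul]
  ring

lemma hellingerAffinity_multivariateGaussian (hS : S.PosDef) (hT : T.PosDef) :
    hellingerAffinity volume (multivariateGaussian 0 S) (multivariateGaussian 0 T) =
      √((√((2 * Real.pi) ^ Fintype.card ι * S.det))⁻¹ *
        (√((2 * Real.pi) ^ Fintype.card ι * T.det))⁻¹) *
      √((2 * Real.pi) ^ Fintype.card ι / ((1 / 2 : ℝ) • (S⁻¹ + T⁻¹)).det) := by
  have hK : ((1 / 2 : ℝ) • (S⁻¹ + T⁻¹)).PosDef := (hS.inv.add hT.inv).smul one_half_pos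
  rw [← integral_exp_neg_dotProduct_mulVec hK, ← integral_const_mul]
  refine integral_congr_ae ?_
  filter_upwards [toReal_rnDeriv_multivariateGaussian hS, toReal_rnDeriv_multivariateGaussian hT]
    with x hSx hTx
  rw [hSx, hTx, sqrt_gaussianDensity_mul]

lemma hellingerAffinity_multivariateGaussian_pos (hS : S.PosDef) (hT : T.PosDef) :
    0 < hellingerAffinity volume (multivariateGaussian 0 S) (multivariateGaussian 0 T) := by
  have hK := ((hS.inv.add hT.inv).smul (one_half_pos (α := ℝ))).det_pos
  have hS0 := hS.det_pos
  have hT0 := hT.det_pos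
  rw [hellingerAffinity_multivariateGaussian hS hT]
  positivity

lemma hellingerAffinity_multivariateGaussian_pow_four (hS : S.PosDef) (hT : T.PosDef) :
    hellingerAffinity volume (multivariateGaussian 0 S) (multivariateGaussian 0 T) ^ 4 *
      ((1 / 2 : ℝ) • (S + T)).det ^ 2 = S.det * T.det := by
  have hK := ((hS.inv.add hT.inv).smul (one_half_pos (α := ℝ))).det_pos
  have hS0 := hS.det_pos
  have hT0 := hT.det_pos
  have pow_four (y : ℝ) : y ^ 4 = (y ^ 2) ^ 2 := by ring
  rw [hellingerAffinity_multivariateGaussian hS hT, ← det_half_inv_add_inv hS0.ne' hT0.ne',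
    pow_four, mul_pow, Real.sq_sqrt (by positivity), Real.sq_sqrt (by positivity), mul_pow,
    mul_pow, inv_pow, inv_pow, Real.sq_sqrt (by positivity), Real.sq_sqrt (by positivity)]
  field_simp

/-! ### The Kullback-Leibler divergence of two Gaussian laws -/

lemma memLp_eval_multivariateGaussian (S : Matrix ι ι ℝ) (i : ι) :
    MemLp (fun x : EuclideanSpace ℝ ι => x i) 2 (multivariateGaussian 0 S) :=
  IsGaussian.memLp_two_id.continuousLinearMap_comp (EuclideanSpace.proj (𝕜 := ℝ) i)

lemma integrable_eval_mul_eval_multivariateGaussian (S : Matrix ι ι ℝ) (i j : ι) :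
    Integrable (fun x : EuclideanSpace ℝ ι => x i * x j) (multivariateGaussian 0 S) :=
  (memLp_eval_multivariateGaussian S i).integrable_mul (memLp_eval_multivariateGaussian S j)

lemma integral_eval_mul_eval_multivariateGaussian (hS : S.PosSemidef) (i j : ι) :
    ∫ x, x i * x j ∂(multivariateGaussian 0 S) = S i j := by
  have hmean (i : ι) : ∫ x, x i ∂(multivariateGaussian 0 S) = 0 := by
    simpa using (EuclideanSpace.proj (𝕜 := ℝ) i).integral_comp_comm
      (IsGaussian.integrable_fun_id (μ := multivariateGaussian 0 S))
  have hcov := covariance_eval_multivariateGaussian (μ := 0) hS i j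
  rwa [covariance_eq_sub (memLp_eval_multivariateGaussian S i)
    (memLp_eval_multivariateGaussian S j), hmean, zero_mul, sub_zero] at hcov

lemma multivariateGaussian_zero_injOn :
    Set.InjOn (multivariateGaussian (0 : EuclideanSpace ℝ ι)) {S | S.PosSemidef} := by
  intro S hS T hT h
  ext i j
  rw [← integral_eval_mul_eval_multivariateGaussian hS, h,
    integral_eval_mul_eval_multivariateGaussian hT]

omit [DecidableEq ι] in
lemma dotProduct_mulVec_eq_sum (K : Matrix ι ι ℝ) (x : ι → ℝ) :
    x ⬝ᵥ K *ᵥ x = ∑ i, ∑ j, K i j * (x i * x j) := by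
  simp only [dotProduct, mulVec, Finset.mul_sum]
  exact Finset.sum_congr rfl fun i _ => Finset.sum_congr rfl fun j _ => by ring

lemma integrable_dotProduct_mulVec_multivariateGaussian (S K : Matrix ι ι ℝ) :
    Integrable (fun x : EuclideanSpace ℝ ι => ofLp x ⬝ᵥ K *ᵥ ofLp x)
      (multivariateGaussian 0 S) := by
  simp_rw [dotProduct_mulVec_eq_sum]
  exact integrable_finsetSum _ fun i _ => integrable_finsetSum _ fun j _ =>
    (integrable_eval_mul_eval_multivariateGaussian S i j).const_mul _

lemma integral_dotProduct_mulVec_multivariateGaussian (hS : S.PosSemidef) (K : Matrix ι ι ℝ) :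
    ∫ x, ofLp x ⬝ᵥ K *ᵥ ofLp x ∂(multivariateGaussian 0 S) = (K * S).trace := by
  have hint (i j : ι) := (integrable_eval_mul_eval_multivariateGaussian S i j).const_mul (K i j)
  have hsymm (i j : ι) : S j i = S i j := by simpa using hS.isHermitian.apply i j
  simp_rw [dotProduct_mulVec_eq_sum,
    integral_finsetSum _ fun i _ => integrable_finsetSum _ fun j _ => hint i j,
    integral_finsetSum _ fun j _ => hint _ j, integral_const_mul,
    integral_eval_mul_eval_multivariateGaussian hS, trace, diag, Matrix.mul_apply, hsymm]

lemma multivariateGaussian_absolutelyContinuous (hS : S.PosDef) (hT : T.PosDef) :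
    multivariateGaussian 0 S ≪ multivariateGaussian 0 T :=
  (multivariateGaussian_absolutelyContinuous_volume hS).trans
    (volume_absolutelyContinuous_multivariateGaussian hT)

lemma llr_multivariateGaussian (hS : S.PosDef) (hT : T.PosDef) :
    llr (multivariateGaussian 0 S) (multivariateGaussian 0 T) =ᵐ[multivariateGaussian 0 S]
      fun x => (Real.log T.det - Real.log S.det) / 2 +
        (1 / 2) * (ofLp x ⬝ᵥ (T⁻¹ - S⁻¹) *ᵥ ofLp x) := by
  have hchain := Measure.rnDeriv_mul_rnDeriv (κ := volume)
    (multivariateGaussian_absolutelyContinuous hS hT)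
  refine (multivariateGaussian_absolutelyContinuous_volume hS).ae_le ?_
  filter_upwards [hchain, toReal_rnDeriv_multivariateGaussian hS,
    toReal_rnDeriv_multivariateGaussian hT] with x hx hSx hTx
  have hratio := congrArg ENNReal.toReal hx
  rw [Pi.mul_apply, ENNReal.toReal_mul, hSx, hTx] at hratio
  rw [llr, eq_div_of_mul_eq (gaussianDensity_pos hT x).ne' hratio,
    Real.log_div (gaussianDensity_pos hS x).ne' (gaussianDensity_pos hT x).ne',
    log_gaussianDensity hS, log_gaussianDensity hT, sub_mulVec, dotProduct_sub]
  ring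

lemma integrable_llr_multivariateGaussian (hS : S.PosDef) (hT : T.PosDef) :
    Integrable (llr (multivariateGaussian 0 S) (multivariateGaussian 0 T))
      (multivariateGaussian 0 S) :=
  ((integrable_const _).add
    ((integrable_dotProduct_mulVec_multivariateGaussian S _).const_mul _)).congr
    (llr_multivariateGaussian hS hT).symm

lemma klDiv_multivariateGaussian_ne_top (hS : S.PosDef) (hT : T.PosDef) :
    InformationTheory.klDiv (multivariateGaussian 0 S) (multivariateGaussian 0 T) ≠ ∞ :=
  InformationTheory.klDiv_ne_top (multivariateGaussian_absolutelyContinuous hS hT)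
    (integrable_llr_multivariateGaussian hS hT)

theorem toReal_klDiv_multivariateGaussian (hS : S.PosDef) (hT : T.PosDef) :
    (InformationTheory.klDiv (multivariateGaussian 0 S) (multivariateGaussian 0 T)).toReal =
      (Real.log T.det - Real.log S.det + (T⁻¹ * S).trace - Fintype.card ι) / 2 := by
  rw [InformationTheory.toReal_klDiv_of_measure_eq
      (multivariateGaussian_absolutelyContinuous hS hT) (by rw [measure_univ, measure_univ]),
    integral_congr_ae (llr_multivariateGaussian hS hT), integral_add (integrable_const _)
      ((integrable_dotProduct_mulVec_multivariateGaussian S _).const_mul _),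
    integral_const, integral_const_mul,
    integral_dotProduct_mulVec_multivariateGaussian hS.posSemidef, sub_mul, trace_sub,
    nonsing_inv_mul _ hS.det_pos.ne'.isUnit, trace_one, probReal_univ, one_smul]
  ring

end Gaussian

/-! ### The Kullback-Leibler projection -/

section Projection

open Matrix

variable {S T : Mat3}

lemma sq_apply_lt_mul_diag {ι : Type*} {S : Matrix ι ι ℝ} (hS : S.PosDef) {i j : ι}
    (hij : i ≠ j) : S i j ^ 2 < S i i * S j j := by
  have hinj : Function.Injective ![i, j] := by
    intro a b
    fin_cases a <;> fin_cases b <;> simp [hij, hij.symm]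
  have hdet := (hS.submatrix hinj).det_pos
  have hsymm : S j i = S i j := by simpa using hS.isHermitian.apply i j
  rw [det_fin_two] at hdet
  simp only [submatrix_apply, cons_val_zero, cons_val_one, hsymm] at hdet
  linarith

lemma det_closestCov_mul (hS : S.PosDef) :
    (closestCov S).det * S 2 2 =
      (S 0 0 * S 2 2 - S 0 2 ^ 2) * (S 1 1 * S 2 2 - S 1 2 ^ 2) := by
  have h2 := (hS.diag_pos (i := 2)).ne'
  rw [det_fin_three]
  simp only [closestCov, of_apply, cons_val', cons_val_zero, cons_val_fin_one, cons_val_one,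
    cons_val]
  field_simp
  ring

lemma closestCov_eq_diagonal_add (hS : S.PosDef) :
    closestCov S =
      diagonal ![S 0 0 - S 0 2 ^ 2 / S 2 2, S 1 1 - S 1 2 ^ 2 / S 2 2, 0] +
        (S 2 2)⁻¹ • vecMulVec ![S 0 2, S 1 2, S 2 2] (star ![S 0 2, S 1 2, S 2 2]) := by
  have h2 := (hS.diag_pos (i := 2)).ne'
  ext i j
  fin_cases i <;> fin_cases j <;> simp [closestCov, vecMulVec, div_eq_inv_mul, sq, mul_comm, h2]

lemma closestCov_posDef (hS : S.PosDef) : (closestCov S).PosDef := by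
  have h2 := hS.diag_pos (i := 2)
  have h02 := sq_apply_lt_mul_diag hS (show (0 : Fin 3) ≠ 2 by decide)
  have h12 := sq_apply_lt_mul_diag hS (show (1 : Fin 3) ≠ 2 by decide)
  have hpsd : (closestCov S).PosSemidef := by
    rw [closestCov_eq_diagonal_add hS]
    refine .add (.diagonal fun i => ?_)
      ((posSemidef_vecMulVec_self_star _).smul (inv_pos.2 h2).le)
    fin_cases i <;> simp [div_le_iff₀ h2, h02.le, h12.le]
  have hdet : 0 < (closestCov S).det := by
    refine pos_of_mul_pos_left ?_ h2.le
    rw [det_closestCov_mul hS]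
    exact mul_pos (sub_pos.2 h02) (sub_pos.2 h12)
  exact hpsd.posDef_iff_isUnit.2 ((isUnit_iff_isUnit_det _).2 hdet.ne'.isUnit)

lemma closestCov_mem_model1 (hS : S.PosDef) : closestCov S ∈ model1 := by
  have h2 := (hS.diag_pos (i := 2)).ne'
  exact ⟨closestCov_posDef hS, by simp [closestCov, h2]⟩

lemma inv_zero_one_eq_zero_of_mem_model1 (hT : T ∈ model1) : T⁻¹ 0 1 = 0 := by
  have hsymm : T 2 1 = T 1 2 := by simpa using hT.1.isHermitian.apply 1 2
  have hminor : T 0 2 * T 1 2 - T 0 1 * T 2 2 = 0 := sub_eq_zero.2 hT.2.symm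
  rw [inv_def, Matrix.smul_apply, adjugate_fin_three, smul_eq_mul]
  refine mul_eq_zero_of_right _ ?_
  simp only [hsymm, of_apply, cons_val', cons_val_one, cons_val_zero]
  linarith

lemma trace_inv_mul_closestCov (hS : S.PosDef) (hT : T ∈ model1) :
    (T⁻¹ * closestCov S).trace = (T⁻¹ * S).trace := by
  have h01 := inv_zero_one_eq_zero_of_mem_model1 hT
  have h10 : T⁻¹ 1 0 = 0 := by simpa [h01] using hT.1.inv.isHermitian.apply 0 1
  have hsymm (i j : Fin 3) : S j i = S i j := by simpa using hS.isHermitian.apply i j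
  simp [trace, Fin.sum_univ_three, Matrix.mul_apply, h01, h10, closestCov, hsymm 0 2, hsymm 1 2]

lemma klDiv_gaussianLaw_eq_add (hS : S.PosDef) (hT : T ∈ model1) :
    InformationTheory.klDiv (gaussianLaw S) (gaussianLaw T) =
      InformationTheory.klDiv (gaussianLaw S) (gaussianLaw (closestCov S)) +
        InformationTheory.klDiv (gaussianLaw (closestCov S)) (gaussianLaw T) := by
  have hC := closestCov_posDef hS
  have hSC := klDiv_multivariateGaussian_ne_top hS hC
  have hCT := klDiv_multivariateGaussian_ne_top hC hT.1
  have htrace : ((closestCov S)⁻¹ * S).trace = Fintype.card (Fin 3) := by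
    rw [← trace_inv_mul_closestCov hS (closestCov_mem_model1 hS),
      nonsing_inv_mul _ hC.det_pos.ne'.isUnit, trace_one]
  unfold gaussianLaw
  rw [← ENNReal.toReal_eq_toReal_iff' (klDiv_multivariateGaussian_ne_top hS hT.1)
      (ENNReal.add_ne_top.2 ⟨hSC, hCT⟩), ENNReal.toReal_add hSC hCT,
    toReal_klDiv_multivariateGaussian hS hT.1, toReal_klDiv_multivariateGaussian hS hC,
    toReal_klDiv_multivariateGaussian hC hT.1, trace_inv_mul_closestCov hS hT, htrace]
  ring

instance (S : Mat3) : IsProbabilityMeasure (gaussianLaw S) := by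
  unfold gaussianLaw
  infer_instance

instance (S : Mat3) (n : ℕ) : IsProbabilityMeasure (sampleLaw S n) := by
  unfold sampleLaw
  infer_instance

theorem isKLProjection_model1_iff (hS : S.PosDef) :
    IsKLProjection model1 S T ↔ T = closestCov S := by
  constructor
  · rintro ⟨hT, hmin⟩
    have hC := closestCov_posDef hS
    have hle := hmin _ (closestCov_mem_model1 hS)
    have hfin := klDiv_multivariateGaussian_ne_top hS hC
    rw [klDiv_gaussianLaw_eq_add hS hT] at hle
    have hzero : InformationTheory.klDiv (gaussianLaw (closestCov S)) (gaussianLaw T) = 0 := by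
      by_contra hne
      exact (ENNReal.lt_add_right hfin hne).not_ge hle
    rw [InformationTheory.klDiv_eq_zero_iff] at hzero
    exact (multivariateGaussian_zero_injOn hC.posSemidef hT.1.posSemidef hzero).symm
  · rintro rfl
    refine ⟨closestCov_mem_model1 hS, fun T hT => ?_⟩
    rw [klDiv_gaussianLaw_eq_add hS hT]
    exact le_self_add

end Projection

/-! ### The Hellinger distance to the projection -/

section Correlations

open Matrix

variable {S : Mat3}

lemma corr_sq (hS : S.PosDef) (i j : Fin 3) : corr S i j ^ 2 = S i j ^ 2 / (S i i * S j j) := by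
  rw [corr, div_pow, Real.sq_sqrt (mul_pos hS.diag_pos hS.diag_pos).le]

lemma corr_sq_mul_corr_sq_pos (hS : S ∈ model0 \ model1) :
    0 < corr S 0 2 ^ 2 * corr S 1 2 ^ 2 := by
  obtain ⟨⟨hp, h01⟩, hnot⟩ := hS
  have hne : S 0 2 * S 1 2 ≠ 0 := fun h => hnot ⟨hp, by rw [h01, h, zero_mul]⟩
  have h0 := hp.diag_pos (i := 0)
  have h1 := hp.diag_pos (i := 1)
  have h2 := hp.diag_pos (i := 2)
  rw [corr_sq hp, corr_sq hp, div_mul_div_comm, ← mul_pow]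
  positivity

lemma det_eq_of_mem_model0 (hS : S ∈ model0) :
    S.det = S 0 0 * S 1 1 * S 2 2 * (1 - corr S 0 2 ^ 2 - corr S 1 2 ^ 2) := by
  obtain ⟨hp, h01⟩ := hS
  have h0 := (hp.diag_pos (i := 0)).ne'
  have h1 := (hp.diag_pos (i := 1)).ne'
  have h2 := (hp.diag_pos (i := 2)).ne'
  have hsymm (i j : Fin 3) : S j i = S i j := by simpa using hp.isHermitian.apply i j
  rw [det_fin_three, corr_sq hp, corr_sq hp, hsymm 0 1, hsymm 0 2, hsymm 1 2, h01]
  field_simp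
  ring

lemma det_closestCov (hS : S.PosDef) :
    (closestCov S).det =
      S 0 0 * S 1 1 * S 2 2 * ((1 - corr S 0 2 ^ 2) * (1 - corr S 1 2 ^ 2)) := by
  have h0 := (hS.diag_pos (i := 0)).ne'
  have h1 := (hS.diag_pos (i := 1)).ne'
  have h2 := (hS.diag_pos (i := 2)).ne'
  rw [eq_div_of_mul_eq h2 (det_closestCov_mul hS), corr_sq hS, corr_sq hS]
  field_simp

lemma det_half_add_closestCov (hS : S ∈ model0) :
    ((1 / 2 : ℝ) • (S + closestCov S)).det =
      S 0 0 * S 1 1 * S 2 2 *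
        (1 - corr S 0 2 ^ 2 - corr S 1 2 ^ 2 + 3 / 4 * (corr S 0 2 ^ 2 * corr S 1 2 ^ 2)) := by
  obtain ⟨hp, h01⟩ := hS
  have h0 := (hp.diag_pos (i := 0)).ne'
  have h1 := (hp.diag_pos (i := 1)).ne'
  have h2 := (hp.diag_pos (i := 2)).ne'
  have hsymm (i j : Fin 3) : S j i = S i j := by simpa using hp.isHermitian.apply i j
  rw [det_fin_three, corr_sq hp, corr_sq hp]
  simp only [closestCov, Matrix.smul_apply, Matrix.add_apply, smul_eq_mul, of_apply, cons_val',
    cons_val_zero, cons_val_fin_one, cons_val_one, cons_val, h01, hsymm 0 1, hsymm 0 2, hsymm 1 2]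
  field_simp
  ring

lemma hellingerAffinity_closestCov (hS : S ∈ model0) :
    hellingerAffinity volume (gaussianLaw S) (gaussianLaw (closestCov S)) ^ 4 *
        (1 - corr S 0 2 ^ 2 - corr S 1 2 ^ 2 + 3 / 4 * (corr S 0 2 ^ 2 * corr S 1 2 ^ 2)) ^ 2 =
      (1 - corr S 0 2 ^ 2 - corr S 1 2 ^ 2) *
        ((1 - corr S 0 2 ^ 2) * (1 - corr S 1 2 ^ 2)) := by
  have hp := hS.1
  have hD : (S 0 0 * S 1 1 * S 2 2) ^ 2 ≠ 0 :=
    pow_ne_zero 2 (mul_pos (mul_pos hp.diag_pos hp.diag_pos) hp.diag_pos).ne'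
  have haff := hellingerAffinity_multivariateGaussian_pow_four hp (closestCov_posDef hp)
  rw [det_half_add_closestCov hS, det_closestCov hp, det_eq_of_mem_model0 hS] at haff
  unfold gaussianLaw
  refine mul_left_cancel₀ hD ?_
  linear_combination haff

lemma corr_sq_add_corr_sq_lt_one (hS : S ∈ model0) : corr S 0 2 ^ 2 + corr S 1 2 ^ 2 < 1 := by
  have hp := hS.1
  have hD : 0 < S 0 0 * S 1 1 * S 2 2 :=
    mul_pos (mul_pos hp.diag_pos hp.diag_pos) hp.diag_pos
  have hdet := hp.det_pos
  rw [det_eq_of_mem_model0 hS] at hdet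
  linarith [pos_of_mul_pos_right hdet hD.le]

lemma bounds_of_pow_four_mul_sq_eq {s t r b : ℝ} (hs : 0 ≤ s) (ht : 0 ≤ t) (hst : s + t ≤ r)
    (hr : r < 1) (hb0 : 0 ≤ b) (hb1 : b ≤ 1)
    (hb : b ^ 4 * (1 - s - t + 3 / 4 * (s * t)) ^ 2 = (1 - s - t) * ((1 - s) * (1 - t))) :
    (1 - r) / 8 * (s * t) ≤ 1 - b ∧ 1 - b ≤ 1 / (1 - r) ^ 2 * (s * t) ∧ (1 - r) ^ 2 ≤ b := by
  set w := 1 - s - t + 3 / 4 * (s * t) with hw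
  have hst0 : 0 ≤ s * t := mul_nonneg hs ht
  have hrw : (1 - r) ^ 2 ≤ w ^ 2 := pow_le_pow_left₀ (by linarith) (by linarith) 2
  have hw1 : w ^ 2 ≤ 1 := by
    refine pow_le_one₀ (by linarith) ?_
    nlinarith
  have hdefect : (1 - b ^ 4) * w ^ 2 = s * t * ((1 - s - t) / 2 + 9 / 16 * (s * t)) := by
    rw [sub_mul, hb, hw]
    ring
  have hb4 : b ^ 4 ≤ b := pow_le_of_le_one hb0 hb1 (by norm_num)
  refine ⟨?_, ?_, ?_⟩
  · have hbernoulli := one_add_mul_sub_le_pow (by linarith : -1 ≤ b) 4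
    push_cast at hbernoulli
    have hlower : (1 - r) / 2 * (s * t) ≤ 1 - b ^ 4 := by
      calc (1 - r) / 2 * (s * t) ≤ s * t * ((1 - s - t) / 2 + 9 / 16 * (s * t)) := by nlinarith
        _ = (1 - b ^ 4) * w ^ 2 := hdefect.symm
        _ ≤ 1 - b ^ 4 := mul_le_of_le_one_right (by linarith) hw1
    linarith
  · rw [div_mul_eq_mul_div, one_mul, le_div_iff₀ (by nlinarith)]
    calc (1 - b) * (1 - r) ^ 2 ≤ (1 - b ^ 4) * w ^ 2 := by gcongr; linarith
      _ = s * t * ((1 - s - t) / 2 + 9 / 16 * (s * t)) := hdefect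
      _ ≤ s * t := mul_le_of_le_one_right hst0 (by nlinarith)
  · calc (1 - r) ^ 2 ≤ (1 - s - t) * ((1 - s) * (1 - t)) := by nlinarith
      _ = b ^ 4 * w ^ 2 := hb.symm
      _ ≤ b := (mul_le_of_le_one_right (by positivity) hw1).trans hb4

lemma gaussianLaw_absolutelyContinuous (hS : S.PosDef) : gaussianLaw S ≪ volume :=
  multivariateGaussian_absolutelyContinuous_volume hS

lemma hellingerSq_closestCov_bounds (hS : S ∈ model0) {r : ℝ} (hr : r < 1)
    (hcorr : corr S 0 2 ^ 2 + corr S 1 2 ^ 2 ≤ r) :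
    (1 - r) / 8 * (corr S 0 2 ^ 2 * corr S 1 2 ^ 2) ≤
        hellingerSq volume (gaussianLaw S) (gaussianLaw (closestCov S)) ∧
      hellingerSq volume (gaussianLaw S) (gaussianLaw (closestCov S)) ≤
        1 / (1 - r) ^ 2 * (corr S 0 2 ^ 2 * corr S 1 2 ^ 2) ∧
      hellingerSq volume (gaussianLaw S) (gaussianLaw (closestCov S)) ≤ 1 - (1 - r) ^ 2 := by
  have hS_ac := gaussianLaw_absolutelyContinuous hS.1
  have hC_ac := gaussianLaw_absolutelyContinuous (closestCov_posDef hS.1)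
  obtain ⟨hlower, hupper, hfar⟩ := bounds_of_pow_four_mul_sq_eq (sq_nonneg _) (sq_nonneg _) hcorr hr
    (hellingerAffinity_multivariateGaussian_pos hS.1 (closestCov_posDef hS.1)).le
    (hellingerAffinity_le_one hS_ac hC_ac) (hellingerAffinity_closestCov hS)
  rw [hellingerSq_eq_one_sub_hellingerAffinity hS_ac hC_ac]
  exact ⟨hlower, hupper, by unfold gaussianLaw; linarith⟩

variable {α : Type*} {l : Filter α} {S0 : α → Mat3} {r : ℝ}

theorem isTheta_hellingerSq_closestCov (hS0 : ∀ k, S0 k ∈ model0) (hr : r < 1)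
    (hcorr : ∀ᶠ k in l, corr (S0 k) 0 2 ^ 2 + corr (S0 k) 1 2 ^ 2 ≤ r) :
    (fun k => hellingerSq volume (gaussianLaw (S0 k)) (gaussianLaw (closestCov (S0 k)))) =Θ[l]
      fun k => corr (S0 k) 0 2 ^ 2 * corr (S0 k) 1 2 ^ 2 := by
  have hc : 0 < (1 - r) / 8 := by linarith
  constructor
  · refine .of_bound (1 / (1 - r) ^ 2) (hcorr.mono fun k hk => ?_)
    obtain ⟨hlower, hupper, -⟩ := hellingerSq_closestCov_bounds (hS0 k) hr hk
    rwa [Real.norm_of_nonneg ((by positivity : (0 : ℝ) ≤ _).trans hlower),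
      Real.norm_of_nonneg (by positivity)]
  · refine .of_bound ((1 - r) / 8)⁻¹ (hcorr.mono fun k hk => ?_)
    obtain ⟨hlower, -, -⟩ := hellingerSq_closestCov_bounds (hS0 k) hr hk
    rwa [Real.norm_of_nonneg ((by positivity : (0 : ℝ) ≤ _).trans hlower),
      Real.norm_of_nonneg (by positivity), ← div_eq_inv_mul, le_div_iff₀' hc]

lemma exists_eventually_corr_sq_add_corr_sq_le [l.NeBot] {Slim : Mat3}
    (hS0 : ∀ k, S0 k ∈ model0) (hlim : Tendsto S0 l (𝓝 Slim)) (hSlim : Slim.PosDef) :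
    ∃ r < 1, ∀ᶠ k in l, corr (S0 k) 0 2 ^ 2 + corr (S0 k) 1 2 ^ 2 ≤ r := by
  have hentry (i j : Fin 3) : Tendsto (fun k => S0 k i j) l (𝓝 (Slim i j)) :=
    (hlim.apply_nhds i).apply_nhds j
  have hmem : Slim ∈ model0 :=
    ⟨hSlim, tendsto_nhds_unique (hentry 0 1) (by simp [fun k => (hS0 k).2])⟩
  have hcorr (i j : Fin 3) : Tendsto (fun k => corr (S0 k) i j) l (𝓝 (corr Slim i j)) :=
    (hentry i j).div ((hentry i i).mul (hentry j j)).sqrt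
      (Real.sqrt_pos.2 (mul_pos hSlim.diag_pos hSlim.diag_pos)).ne'
  obtain ⟨r, hlt, hr⟩ := exists_between (corr_sq_add_corr_sq_lt_one hmem)
  exact ⟨r, hr, (((hcorr 0 2).pow 2).add ((hcorr 1 2).pow 2)).eventually_le_const hlt⟩

end Correlations

theorem mainTheorem9_general (S0 : ℕ → Mat3) (r : ℝ) (hS0 : ∀ k, S0 k ∈ model0 \ model1)
    (hr : r < 1) (hcorr : ∀ᶠ k in atTop, corr (S0 k) 0 2 ^ 2 + corr (S0 k) 1 2 ^ 2 ≤ r) :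
    (∀ k T, IsKLProjection model1 (S0 k) T ↔ T = closestCov (S0 k)) ∧
    ∀ S1 : ℕ → Mat3, (∀ k, IsKLProjection model1 (S0 k) (S1 k)) →
      (fun k => hellingerSq volume (gaussianLaw (S0 k)) (gaussianLaw (S1 k))) =Θ[atTop]
        (fun k => corr (S0 k) 0 2 ^ 2 * corr (S0 k) 1 2 ^ 2) ∧
      ∀ n : ℕ → ℕ,
        (ConsistentSelection (fun k => sampleLaw (S0 k) (n k)) (fun k => sampleLaw (S1 k) (n k)) ↔
          (fun k => 1 / (corr (S0 k) 0 2 ^ 2 * corr (S0 k) 1 2 ^ 2)) =o[atTop]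
            fun k => (n k : ℝ)) ∧
        (Tendsto (fun k => optimalTotalError (sampleLaw (S0 k) (n k)) (sampleLaw (S1 k) (n k)))
            atTop (𝓝 0) ↔
          (fun k => 1 / (corr (S0 k) 0 2 ^ 2 * corr (S0 k) 1 2 ^ 2)) =o[atTop]
            fun k => (n k : ℝ)) ∧
        ((0 < liminf (fun k =>
              optimalTotalError (sampleLaw (S0 k) (n k)) (sampleLaw (S1 k) (n k))) atTop ∧
            limsup (fun k =>
              optimalTotalError (sampleLaw (S0 k) (n k)) (sampleLaw (S1 k) (n k))) atTop < 1) ↔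
          (fun k => (n k : ℝ)) =Θ[atTop]
            fun k => 1 / (corr (S0 k) 0 2 ^ 2 * corr (S0 k) 1 2 ^ 2)) := by
  have hp (k : ℕ) : (S0 k).PosDef := (hS0 k).1.1
  refine ⟨fun k T => isKLProjection_model1_iff (hp k), fun S1 hS1 => ?_⟩
  obtain rfl : S1 = fun k => closestCov (S0 k) :=
    funext fun k => (isKLProjection_model1_iff (hp k)).1 (hS1 k)
  have hP (k : ℕ) := gaussianLaw_absolutelyContinuous (hp k)
  have hQ (k : ℕ) := gaussianLaw_absolutelyContinuous (closestCov_posDef (hp k))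
  have hβ : 1 - (1 - r) ^ 2 < 1 := by linarith [pow_pos (sub_pos.2 hr) 2]
  have hH := hcorr.mono fun k hk => (hellingerSq_closestCov_bounds (hS0 k).1 hr hk).2.2
  have hΘ := isTheta_hellingerSq_closestCov (fun k => (hS0 k).1) hr hcorr
  have hne : ∀ᶠ k in atTop, corr (S0 k) 0 2 ^ 2 * corr (S0 k) 1 2 ^ 2 ≠ 0 :=
    .of_forall fun k => (corr_sq_mul_corr_sq_pos (hS0 k)).ne'
  refine ⟨hΘ, fun n => ?_⟩
  have hzero := tendsto_optimalTotalError_pi_iff hP hQ hβ hH hΘ hne n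
  exact ⟨(consistentSelection_iff_tendsto_optimalTotalError _ _).trans hzero, hzero,
    liminf_limsup_optimalTotalError_pi_iff hP hQ hβ hH hΘ hne n⟩

end MarginalVsConditional

open MarginalVsConditional in
theorem mainTheorem9
    (S0 : ℕ → Matrix (Fin 3) (Fin 3) ℝ) (Slim : Matrix (Fin 3) (Fin 3) ℝ)
    (hS0 : ∀ k, S0 k ∈ model0 \ model1)
    (hlim : Tendsto S0 atTop (𝓝 Slim)) (hSlim : Slim.PosDef) :
    -- the closest element of the other model exists, is unique, and has the explicit form
    (∀ k T, IsKLProjection model1 (S0 k) T ↔ T = closestCov (S0 k)) ∧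
    ∀ S1 : ℕ → Matrix (Fin 3) (Fin 3) ℝ, (∀ k, IsKLProjection model1 (S0 k) (S1 k)) →
      (fun k => hellingerSq volume (gaussianLaw (S0 k)) (gaussianLaw (S1 k))) =Θ[atTop]
        (fun k => corr (S0 k) 0 2 ^ 2 * corr (S0 k) 1 2 ^ 2) ∧
      ∀ n : ℕ → ℕ,
        (ConsistentSelection (fun k => sampleLaw (S0 k) (n k)) (fun k => sampleLaw (S1 k) (n k)) ↔
          (fun k => 1 / (corr (S0 k) 0 2 ^ 2 * corr (S0 k) 1 2 ^ 2)) =o[atTop]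
            fun k => (n k : ℝ)) ∧
        (Tendsto (fun k => optimalTotalError (sampleLaw (S0 k) (n k)) (sampleLaw (S1 k) (n k)))
            atTop (𝓝 0) ↔
          (fun k => 1 / (corr (S0 k) 0 2 ^ 2 * corr (S0 k) 1 2 ^ 2)) =o[atTop]
            fun k => (n k : ℝ)) ∧
        ((0 < liminf (fun k =>
              optimalTotalError (sampleLaw (S0 k) (n k)) (sampleLaw (S1 k) (n k))) atTop ∧
            limsup (fun k =>
              optimalTotalError (sampleLaw (S0 k) (n k)) (sampleLaw (S1 k) (n k))) atTop < 1) ↔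
          (fun k => (n k : ℝ)) =Θ[atTop]
            fun k => 1 / (corr (S0 k) 0 2 ^ 2 * corr (S0 k) 1 2 ^ 2)) := by
  obtain ⟨r, hr, hcorr⟩ := exists_eventually_corr_sq_add_corr_sq_le (fun k => (hS0 k).1) hlim hSlim
  exact mainTheorem9_general S0 r hS0 hr hcorr
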